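/- An abstract state space is a real ordered Banach space $X$ with a closed generating positive cone $X_+$ on which the norm is additive; $\Psi$ denotes the linear functional on $X$ with $\langle\Psi,u\rangle=\|u\|$ for $u\in X_+$. An operator $T$ is positive if $TX_+\subseteq X_+$, and substochastic if moreover $\|Tu\|\le\|u\|$ for $u\in X_+$; a semigroup is positive (substochastic) if all its operators are. Linear operators $A,B$ with $D(A)\subseteq D(B)\subseteq X$ satisfy Kato's conditions if (i) $A$ generates a substochastic $C_0$-semigroup, (ii) $Bu\ge 0$ for $u\in D(A)_+:=D(A)\cap X_+$, and (iii) $\langle\Psi,(A+B)u\rangle\le 0$ for $u\in D(A)_+$. The Kato semigroup for $A,B$ is then the substochastic $C_0$-semigroup $(V(t))_{t\ge0}$ whose generator $G$ extends $A+B$ and satisfies $R(\lambda,G)u=\sum_{k\ge0}R(\lambda,A)(BR(\lambda,A))^ku$ for all $\lambda>0$, $u\in X$. With $a(u)=-\langle\Psi,Au+Bu\rangle$ on $D(A)$, let $\bar a$ be the functional on $D(G)$ given by $\bar a(R(\lambda,G)u)=\sum_{k\ge0}a\big(R(\lambda,A)(BR(\lambda,A))^ku\big)$ (it does not depend on $\lambda>0$).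 The semigroup $V$ is honest if $\|V(t)u\|-\|u\|=-\bar a\big(\int_0^tV(s)u\,ds\big)$ for all $t\ge0$ and $u\in X_+$, and dishonest otherwise. Proposition. Let $X$ be an abstract state space and let $A,B$ satisfy Kato's conditions, with dishonest Kato semigroup. Let $K$ be a bounded positive operator on $X$ such that the $C_0$-semigroup generated by $A-K$ (with domain $D(A)$) is positive. Then $A-K,B$ satisfy Kato's conditions, and the Kato semigroup for $A-K,B$ is also dishonest. -/

import Mathlib

open Filter Topology

/-- An abstract state space: a real ordered Banach space (closed proper convex cone, the order being
a partial order) whose positive cone is generating and on which the norm is additive. -/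
class AbstractStateSpace (X : Type*) [NormedAddCommGroup X] [NormedSpace ℝ X]
    [PartialOrder X] : Prop extends CompleteSpace X, IsOrderedAddMonoid X where
  smul_nonneg' : ∀ (c : ℝ) (u : X), 0 ≤ c → 0 ≤ u → 0 ≤ c • u
  isClosed_cone : IsClosed {u : X | 0 ≤ u}
  generating : ∀ u : X, ∃ p q : X, 0 ≤ p ∧ 0 ≤ q ∧ u = p - q
  norm_add_of_nonneg : ∀ u v : X, 0 ≤ u → 0 ≤ v → ‖u + v‖ = ‖u‖ + ‖v‖

namespace Kato

noncomputable section

section StateSpace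

variable {X : Type*} [NormedAddCommGroup X] [NormedSpace ℝ X] [PartialOrder X]
  [AbstractStateSpace X]

/-- The value at `u = p - q` (with `p, q ≥ 0`) of the linear extension of the norm. -/
def massFun (u : X) : ℝ :=
  ‖(AbstractStateSpace.generating u).choose‖ -
    ‖(AbstractStateSpace.generating u).choose_spec.choose‖

theorem massFun_eq {u p q : X} (hp : 0 ≤ p) (hq : 0 ≤ q) (h : u = p - q) :
    massFun u = ‖p‖ - ‖q‖ := by
  obtain ⟨h1, h2, h3⟩ := (AbstractStateSpace.generating u).choose_spec.choose_spec
  unfold massFun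
  set p' := (AbstractStateSpace.generating u).choose
  set q' := (AbstractStateSpace.generating u).choose_spec.choose
  have e : p' + q = p + q' := by
    have : p' - q' = p - q := h3.symm.trans h
    rw [sub_eq_sub_iff_add_eq_add] at this
    exact this
  have e' := congrArg norm e
  rw [AbstractStateSpace.norm_add_of_nonneg _ _ h1 hq,
    AbstractStateSpace.norm_add_of_nonneg _ _ hp h2] at e'
  linarith

/-- The linear functional `Ψ` on `X` which coincides with the norm on the positive cone. -/
def massFunctional (X : Type*) [NormedAddCommGroup X] [NormedSpace ℝ X] [PartialOrder X]
    [AbstractStateSpace X] : X →ₗ[ℝ] ℝ where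
  toFun := massFun
  map_add' u v := by
    obtain ⟨p, q, hp, hq, hu⟩ := AbstractStateSpace.generating u
    obtain ⟨r, s, hr, hs, hv⟩ := AbstractStateSpace.generating v
    rw [massFun_eq hp hq hu, massFun_eq hr hs hv,
      massFun_eq (add_nonneg hp hr) (add_nonneg hq hs) (by rw [hu, hv]; abel),
      AbstractStateSpace.norm_add_of_nonneg _ _ hp hr,
      AbstractStateSpace.norm_add_of_nonneg _ _ hq hs]
    ring
  map_smul' c u := by
    obtain ⟨p, q, hp, hq, hu⟩ := AbstractStateSpace.generating u
    rw [massFun_eq hp hq hu]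
    rcases le_total 0 c with hc | hc
    · rw [massFun_eq (AbstractStateSpace.smul_nonneg' c p hc hp)
        (AbstractStateSpace.smul_nonneg' c q hc hq) (by rw [hu, smul_sub]),
        norm_smul, norm_smul, Real.norm_of_nonneg hc]
      simp only [RingHom.id_apply, smul_eq_mul]
      ring
    · have hc' : 0 ≤ -c := by linarith
      rw [massFun_eq (AbstractStateSpace.smul_nonneg' (-c) q hc' hq)
        (AbstractStateSpace.smul_nonneg' (-c) p hc' hp)
        (by rw [hu, smul_sub, neg_smul, neg_smul]; abel),
        norm_smul, norm_smul, Real.norm_of_nonneg hc']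
      simp only [RingHom.id_apply, smul_eq_mul]
      ring

theorem massFunctional_of_nonneg {u : X} (hu : 0 ≤ u) : massFunctional X u = ‖u‖ := by
  have := massFun_eq hu le_rfl (sub_zero u).symm
  simpa [massFunctional] using this

end StateSpace

section Operators

variable {X : Type*} [NormedAddCommGroup X] [NormedSpace ℝ X]

/-- The set of pairs `(x, y)` such that `(S t x - x) / t` tends to `y` as `t` decreases to `0`. -/
def generatorGraph (S : ℝ → X →L[ℝ] X) : Submodule ℝ (X × X) where
  carrier := {z | Tendsto (fun t : ℝ => t⁻¹ • (S t z.1 - z.1)) (𝓝[>] 0) (𝓝 z.2)}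
  zero_mem' := by simp
  add_mem' {z w} hz hw := by
    refine (Tendsto.add hz hw).congr fun t => ?_
    simp only [Prod.fst_add, map_add, ← smul_add]
    congr 1
    abel
  smul_mem' c z hz := by
    refine (Tendsto.const_smul hz c).congr fun t => ?_
    simp only [Prod.smul_fst, map_smul, ← smul_sub]
    exact smul_comm _ _ _

/-- The (infinitesimal) generator of a one-parameter family of bounded operators; its domain consists
of all `x` for which `(S t x - x) / t` converges as `t` decreases to `0`. -/
def generator (S : ℝ → X →L[ℝ] X) : X →ₗ.[ℝ] X := (generatorGraph S).toLinearPMap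

theorem mem_generator_graph (S : ℝ → X →L[ℝ] X) (x y : X) :
    (x, y) ∈ (generator S).graph ↔
      Tendsto (fun t : ℝ => t⁻¹ • (S t x - x)) (𝓝[>] 0) (𝓝 y) := by
  have h : ∀ z ∈ generatorGraph S, z.1 = 0 → z.2 = 0 := by
    rintro ⟨a, b⟩ hz rfl
    have hz' : Tendsto (fun t : ℝ => t⁻¹ • (S t (0 : X) - 0)) (𝓝[>] 0) (𝓝 b) := hz
    simp only [map_zero, sub_zero, smul_zero] at hz'
    exact (tendsto_nhds_unique hz' tendsto_const_nhds)
  unfold generator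
  rw [Submodule.toLinearPMap_graph_eq _ h]
  rfl

/-- A strongly continuous one-parameter semigroup of bounded operators. Only the values `S t` with
`t ≥ 0` are relevant. -/
structure IsC0Semigroup (S : ℝ → X →L[ℝ] X) : Prop where
  map_zero : S 0 = ContinuousLinearMap.id ℝ X
  map_add : ∀ s t : ℝ, 0 ≤ s → 0 ≤ t → S (s + t) = (S s).comp (S t)
  tendsto_zero : ∀ x : X, Tendsto (fun t : ℝ => S t x) (𝓝[>] 0) (𝓝 x)

/-- `R` is the inverse of `l - A`, as a bounded operator on all of `X`. -/
def IsResolvent (A : X →ₗ.[ℝ] X) (l : ℝ) (R : X →L[ℝ] X) : Prop :=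
  (∀ x : X, ∃ h : R x ∈ A.domain, l • R x - A ⟨R x, h⟩ = x) ∧
    ∀ u : A.domain, R (l • (u : X) - A u) = u

open Classical in
/-- The resolvent `R(l, A) = (l - A)⁻¹` for `l` in the resolvent set of `A` (otherwise `0`). -/
def resolventOp (A : X →ₗ.[ℝ] X) (l : ℝ) : X →L[ℝ] X :=
  if h : ∃ R, IsResolvent A l R then h.choose else 0

theorem IsResolvent.unique {A : X →ₗ.[ℝ] X} {l : ℝ} {R R' : X →L[ℝ] X}
    (h : IsResolvent A l R) (h' : IsResolvent A l R') : R = R' := by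
  ext x
  obtain ⟨hx, e⟩ := h.1 x
  have := h'.2 ⟨R x, hx⟩
  simp only [e] at this
  exact this.symm

theorem IsResolvent.resolventOp_eq {A : X →ₗ.[ℝ] X} {l : ℝ} {R : X →L[ℝ] X}
    (h : IsResolvent A l R) : resolventOp A l = R := by
  have h' : ∃ R, IsResolvent A l R := ⟨R, h⟩
  unfold resolventOp
  rw [dif_pos h']
  exact h'.choose_spec.unique h

open Classical in
/-- The value `T x` for `x` in the domain of `T` (otherwise `0`). -/
def valueAt (T : X →ₗ.[ℝ] X) (x : X) : X :=
  if h : x ∈ T.domain then T ⟨x, h⟩ else 0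

theorem valueAt_of_mem (T : X →ₗ.[ℝ] X) (x : T.domain) : valueAt T x = T x := by
  simp [valueAt]

/-- The operator `B R(l, A)`. -/
def BR (A B : X →ₗ.[ℝ] X) (l : ℝ) (u : X) : X := valueAt B (resolventOp A l u)

/-- The vector `R(l, A) (B R(l, A))^k u`. -/
def seriesTerm (A B : X →ₗ.[ℝ] X) (l : ℝ) (k : ℕ) (u : X) : X :=
  resolventOp A l ((BR A B l)^[k] u)

/-- The operator `A - K` with domain `D(A)`, for a bounded operator `K`. -/
def subBounded (A : X →ₗ.[ℝ] X) (K : X →L[ℝ] X) : X →ₗ.[ℝ] X :=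
  A - (K : X →ₗ[ℝ] X).toPMap ⊤

theorem subBounded_domain (A : X →ₗ.[ℝ] X) (K : X →L[ℝ] X) :
    (subBounded A K).domain = A.domain := by
  simp [subBounded, LinearPMap.sub_domain]

variable [PartialOrder X]

/-- A positive (everywhere defined, bounded) operator. -/
def IsPositiveOp (T : X →L[ℝ] X) : Prop := ∀ u : X, 0 ≤ u → 0 ≤ T u

/-- A substochastic operator: positive and norm-contracting on the positive cone. -/
def IsSubstochastic (T : X →L[ℝ] X) : Prop :=
  IsPositiveOp T ∧ ∀ u : X, 0 ≤ u → ‖T u‖ ≤ ‖u‖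

end Operators

section KatoTheorem

variable {X : Type*} [NormedAddCommGroup X] [NormedSpace ℝ X] [PartialOrder X]
  [AbstractStateSpace X]

/-- The conditions of Kato's theorem on the pair `A, B`. -/
structure KatoConditions (A B : X →ₗ.[ℝ] X) : Prop where
  domain_le : A.domain ≤ B.domain
  generates : ∃ U : ℝ → X →L[ℝ] X,
    IsC0Semigroup U ∧ (∀ t : ℝ, 0 ≤ t → IsSubstochastic (U t)) ∧ generator U = A
  nonneg : ∀ u : A.domain, 0 ≤ (u : X) → 0 ≤ B ⟨u, domain_le u.2⟩
  mass_nonpos : ∀ u : A.domain, 0 ≤ (u : X) →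
    massFunctional X (A u + B ⟨u, domain_le u.2⟩) ≤ 0

/-- `V` is the perturbed semigroup of Kato's theorem for `A, B` (the Kato semigroup): the
substochastic strongly continuous semigroup whose generator `G` extends `A + B` and satisfies
`R(l, G) u = ∑ k, R(l, A) (B R(l, A))^k u` for all `l > 0` and all `u`. -/
structure IsKatoSemigroup (A B : X →ₗ.[ℝ] X) (V : ℝ → X →L[ℝ] X) : Prop where
  isC0Semigroup : IsC0Semigroup V
  substochastic : ∀ t : ℝ, 0 ≤ t → IsSubstochastic (V t)
  extends_add : A + B ≤ generator V
  resolvent_eq : ∀ l : ℝ, 0 < l → ∀ u : X,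
    Tendsto (fun n : ℕ => ∑ k ∈ Finset.range (n + 1), seriesTerm A B l k u) atTop
      (𝓝 (resolventOp (generator V) l u))

/-- The functional `a(u) = -⟨Ψ, A u + B u⟩` for `u ∈ D(A)`. -/
def lossA (A B : X →ₗ.[ℝ] X) (u : X) : ℝ :=
  -massFunctional X (valueAt A u + valueAt B u)

/-- The functional `ā` on `D(G)`, computed with the parameter `l > 0`:
`ā (R(l, G) u) = ∑ k, a (R(l, A) (B R(l, A))^k u)`, that is, for `v ∈ D(G)`, the sum of the series
for `u = l v - G v`. Its value does not depend on `l`. -/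
def lossBar (A B G : X →ₗ.[ℝ] X) (l : ℝ) (v : X) : ℝ :=
  ∑' k : ℕ, lossA A B (seriesTerm A B l k (l • v - valueAt G v))

/-- Honesty of the Kato semigroup `V` for `A, B`:
`‖V(t) u‖ - ‖u‖ = -ā (∫₀ᵗ V(s) u ds)` for all `t ≥ 0` and `u ≥ 0`. -/
def IsHonest (A B : X →ₗ.[ℝ] X) (V : ℝ → X →L[ℝ] X) : Prop :=
  ∀ l : ℝ, 0 < l → ∀ t : ℝ, 0 ≤ t → ∀ u : X, 0 ≤ u →
    ‖V t u‖ - ‖u‖ = -lossBar A B (generator V) l (∫ s in (0 : ℝ)..t, V s u)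

/-- A semigroup that is not honest is dishonest. -/
def IsDishonest (A B : X →ₗ.[ℝ] X) (V : ℝ → X →L[ℝ] X) : Prop := ¬ IsHonest A B V

end KatoTheorem

end

end Kato

/-! Write `R = R(l, A)`, `R' = R(l, A - K)`. Honesty is equivalent to `‖(B R)^n u‖ → 0` for all `u ≥
0` and `l > 0`: summing `a` over the resolvent series telescopes, and what is left over is exactly
the limit of `Ψ((B R)^n (l v - G v))` (`tendsto_massFunctional_linBR_pow`, `isHonest_of_tendsto`,
`tendsto_of_isHonest`).

The theorem is proved by contraposition: if the iterates of `B R'` lose all mass, so do those of `B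
R`. The limit mass `L(u) = lim ‖(B R)^n u‖` is additive on the cone, at most `‖u‖`, and invariant
under `B R`. The resolvent identity `R = R' + R K R'` then gives `L(w) = L(B R' w) + L(K R' w)`. The
mass balance `‖B R' w‖ + l ‖R' w‖ + ‖K R' w‖ ≤ ‖w‖` shows that `‖K R' w‖ ≤ θ (‖w‖ - ‖B R' w‖)` with
`θ = ‖K‖ / (‖K‖ + l) < 1`. Hence if `L ≤ c ‖·‖` on the cone, summing along the orbit of `B R'`,
whose norms tend to zero, improves this to `L ≤ θ c ‖·‖`; iterating, `L = 0`
(`limitMass_eq_zero_of_subBounded`). -/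

namespace Kato

/-! ### Absolutely convergent combinations of vectors from the positive unit ball -/

section PositiveBall

/-- The elements of the positive cone of norm at most one. -/
abbrev PositiveBall (X : Type*) [NormedAddCommGroup X] [PartialOrder X] : Type _ :=
  {x : X // 0 ≤ x ∧ ‖x‖ ≤ 1}

variable {X : Type*} [NormedAddCommGroup X] [PartialOrder X]

theorem summable_norm_lp_one (f : lp (fun _ : PositiveBall X => ℝ) 1) :
    Summable fun s => ‖f s‖ := by
  simpa using (lp.memℓp f).summable (by norm_num)

theorem lp_one_norm_eq (f : lp (fun _ : PositiveBall X => ℝ) 1) :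
    ‖f‖ = ∑' s, ‖f s‖ := by
  simpa using lp.norm_eq_tsum_rpow (p := 1) (by norm_num) f

theorem summable_norm_smul [NormedSpace ℝ X] {f : PositiveBall X → ℝ} (hf : Summable fun s => ‖f s‖) :
    Summable fun s : PositiveBall X => ‖f s • (s : X)‖ := by
  refine hf.of_nonneg_of_le (fun _ => norm_nonneg _) fun s => ?_
  rw [norm_smul]
  exact mul_le_of_le_one_right (norm_nonneg _) s.2.2

theorem norm_tsum_smul_le [NormedSpace ℝ X] {f : PositiveBall X → ℝ} (hf : Summable fun s => ‖f s‖) :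
    ‖∑' s : PositiveBall X, f s • (s : X)‖ ≤ ∑' s, ‖f s‖ := by
  have h : ∀ s : PositiveBall X, ‖f s • (s : X)‖ ≤ ‖f s‖ := fun s => by
    rw [norm_smul]
    exact mul_le_of_le_one_right (norm_nonneg _) s.2.2
  have h1 := summable_norm_smul hf
  have h2 := norm_tsum_le_tsum_norm h1
  have h3 := Summable.tsum_le_tsum h h1 hf
  exact h2.trans h3

end PositiveBall

/-! ### Bounded decomposition into positive parts, and its consequences -/

section StateSpaceLemmas

variable {X : Type*} [NormedAddCommGroup X] [NormedSpace ℝ X] [PartialOrder X]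
  [AbstractStateSpace X]

instance isOrderedModule_of_stateSpace : IsOrderedModule ℝ X :=
  IsOrderedModule.of_smul_nonneg fun c hc u hu => AbstractStateSpace.smul_nonneg' c u hc hu

instance orderClosedTopology_of_stateSpace : OrderClosedTopology X where
  isClosed_le' := by
    have h : {p : X × X | p.1 ≤ p.2} = (fun p : X × X => p.2 - p.1) ⁻¹' {u : X | 0 ≤ u} := by
      ext p
      simp
    rw [h]
    exact AbstractStateSpace.isClosed_cone.preimage (by fun_prop)

/-- The canonical map from `ℓ¹` over the positive ball onto the state space. -/
noncomputable def sumPositiveBall (X : Type*) [NormedAddCommGroup X] [NormedSpace ℝ X]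
    [PartialOrder X] [AbstractStateSpace X] : lp (fun _ : PositiveBall X => ℝ) 1 →L[ℝ] X :=
  LinearMap.mkContinuous
    { toFun := fun f => ∑' s : PositiveBall X, f s • (s : X)
      map_add' := fun f g => by
        simp only [lp.coeFn_add, Pi.add_apply, add_smul]
        exact (summable_norm_smul (summable_norm_lp_one f)).of_norm.tsum_add
          (summable_norm_smul (summable_norm_lp_one g)).of_norm
      map_smul' := fun c f => by
        simp only [lp.coeFn_smul, Pi.smul_apply, smul_assoc, RingHom.id_apply]
        exact (summable_norm_smul (summable_norm_lp_one f)).of_norm.tsum_const_smul c }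
    1 fun f => by
      rw [one_mul, lp_one_norm_eq]
      exact norm_tsum_smul_le (summable_norm_lp_one f)

theorem sumPositiveBall_apply (f : lp (fun _ : PositiveBall X => ℝ) 1) :
    sumPositiveBall X f = ∑' s : PositiveBall X, f s • (s : X) := rfl

theorem sumPositiveBall_surjective : Function.Surjective (sumPositiveBall X) := by
  have key : ∀ p : X, 0 ≤ p → ∃ f, sumPositiveBall X f = p := by
    intro p hp
    rcases eq_or_ne p 0 with rfl | h0
    · exact ⟨0, map_zero _⟩
    have hn : ‖p‖ ≠ 0 := norm_ne_zero_iff.2 h0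
    let s : PositiveBall X := ⟨‖p‖⁻¹ • p, smul_nonneg (by positivity) hp, by
      rw [norm_smul, norm_inv, norm_norm, inv_mul_cancel₀ hn]⟩
    classical
    refine ⟨lp.single 1 s ‖p‖, ?_⟩
    rw [sumPositiveBall_apply, tsum_eq_single s]
    · simp [s, smul_smul, hn]
    · intro b hb
      simp [hb]
  intro u
  obtain ⟨p, q, hp, hq, rfl⟩ := AbstractStateSpace.generating u
  obtain ⟨f, rfl⟩ := key p hp
  obtain ⟨g, rfl⟩ := key q hq
  exact ⟨f - g, map_sub _ _ _⟩

/-- The open mapping theorem for `sumPositiveBall` supplies coefficients with controlled `ℓ¹` norm;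
their positive and negative parts give the two vectors. Each part costs at most the full `ℓ¹` norm,
whence the factor `2`. Bounds known only on the cone thus extend to `X`, up to a uniform constant.
-/
theorem exists_nonneg_sub_norm_le (X : Type*) [NormedAddCommGroup X] [NormedSpace ℝ X]
    [PartialOrder X] [AbstractStateSpace X] :
    ∃ C : ℝ, 0 < C ∧ ∀ u : X, ∃ p q : X, 0 ≤ p ∧ 0 ≤ q ∧ u = p - q ∧ ‖p‖ + ‖q‖ ≤ C * ‖u‖ := by
  obtain ⟨C, hC, h⟩ := (sumPositiveBall X).exists_preimage_norm_le sumPositiveBall_surjective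
  refine ⟨2 * C, by positivity, fun u => ?_⟩
  obtain ⟨f, rfl, hf⟩ := h u
  have hs := summable_norm_lp_one f
  have hpos : ∀ s, ‖(f s)⁺‖ ≤ ‖f s‖ := fun s => by
    rw [Real.norm_of_nonneg (posPart_nonneg _), Real.norm_eq_abs]
    exact sup_le (le_abs_self _) (abs_nonneg _)
  have hneg : ∀ s, ‖(f s)⁻‖ ≤ ‖f s‖ := fun s => by
    rw [Real.norm_of_nonneg (negPart_nonneg _), Real.norm_eq_abs]
    exact sup_le (neg_le_abs _) (abs_nonneg _)
  have hp : Summable fun s => ‖(f s)⁺‖ := hs.of_nonneg_of_le (fun _ => norm_nonneg _) hpos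
  have hq : Summable fun s => ‖(f s)⁻‖ := hs.of_nonneg_of_le (fun _ => norm_nonneg _) hneg
  refine ⟨∑' s : PositiveBall X, (f s)⁺ • (s : X), ∑' s : PositiveBall X, (f s)⁻ • (s : X),
    tsum_nonneg fun s => smul_nonneg (posPart_nonneg _) s.2.1,
    tsum_nonneg fun s => smul_nonneg (negPart_nonneg _) s.2.1, ?_, ?_⟩
  · rw [← (summable_norm_smul hp).of_norm.tsum_sub (summable_norm_smul hq).of_norm,
      sumPositiveBall_apply]
    simp only [← sub_smul, posPart_sub_negPart]
  · have h1 := norm_tsum_smul_le hp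
    have h2 := norm_tsum_smul_le hq
    have h3 : ∑' s, ‖(f s)⁺‖ ≤ ∑' s, ‖f s‖ := hp.tsum_le_tsum hpos hs
    have h4 : ∑' s, ‖(f s)⁻‖ ≤ ∑' s, ‖f s‖ := hq.tsum_le_tsum hneg hs
    rw [← lp_one_norm_eq] at h3 h4
    linarith

/-- A linear functional dominated by the norm on the cone is bounded. -/
theorem abs_le_of_abs_le_norm_of_nonneg :
    ∃ C : ℝ, 0 < C ∧ ∀ φ : X →ₗ[ℝ] ℝ, (∀ u, 0 ≤ u → |φ u| ≤ ‖u‖) → ∀ u, |φ u| ≤ C * ‖u‖ := by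
  obtain ⟨C, hC, h⟩ := exists_nonneg_sub_norm_le X
  refine ⟨C, hC, fun φ hφ u => ?_⟩
  obtain ⟨p, q, hp, hq, rfl, hpq⟩ := h u
  rw [map_sub]
  have := abs_sub (φ p) (φ q)
  linarith [hφ p hp, hφ q hq]

theorem continuous_massFunctional : Continuous (massFunctional X) := by
  obtain ⟨C, -, h⟩ := abs_le_of_abs_le_norm_of_nonneg (X := X)
  exact AddMonoidHomClass.continuous_of_bound _ C
    (h _ fun u hu => by rw [massFunctional_of_nonneg hu, abs_norm])

/-- Operators that are contractive on the cone are uniformly bounded. -/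
theorem exists_norm_le_of_norm_le_of_nonneg (X : Type*) [NormedAddCommGroup X] [NormedSpace ℝ X]
    [PartialOrder X] [AbstractStateSpace X] :
    ∃ C : ℝ, 0 < C ∧ ∀ T : X →L[ℝ] X, (∀ u, 0 ≤ u → ‖T u‖ ≤ ‖u‖) → ‖T‖ ≤ C := by
  obtain ⟨C, hC, h⟩ := exists_nonneg_sub_norm_le X
  refine ⟨C, hC, fun T hT => T.opNorm_le_bound hC.le fun u => ?_⟩
  obtain ⟨p, q, hp, hq, rfl, hpq⟩ := h u
  rw [map_sub]
  linarith [hT p hp, hT q hq, norm_sub_le (T p) (T q)]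

end StateSpaceLemmas

/-! ### Strongly continuous semigroups: local boundedness, continuity, integrated orbits -/

section Semigroup

theorem intervalIntegrable_of_continuousOn_Ici {E : Type*} [NormedAddCommGroup E]
    {f : ℝ → E} (hf : ContinuousOn f (Set.Ici 0))
    {a b : ℝ} (ha : 0 ≤ a) (hb : 0 ≤ b) : IntervalIntegrable f MeasureTheory.volume a b :=
  (hf.mono fun _ hx => (le_min ha hb).trans hx.1).intervalIntegrable

variable {X : Type*} [NormedAddCommGroup X] [NormedSpace ℝ X]

theorem valueAt_of_mem_graph {T : X →ₗ.[ℝ] X} {x y : X} (h : (x, y) ∈ T.graph) :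
    valueAt T x = y := by
  obtain ⟨z, rfl, rfl⟩ := (LinearPMap.mem_graph_iff T).1 h
  exact valueAt_of_mem T z

namespace IsC0Semigroup

variable {S : ℝ → X →L[ℝ] X}

theorem apply_zero (hS : IsC0Semigroup S) (x : X) : S 0 x = x := by
  simp [hS.map_zero]

theorem apply_add (hS : IsC0Semigroup S) {s t : ℝ} (hs : 0 ≤ s) (ht : 0 ≤ t) (x : X) :
    S (s + t) x = S s (S t x) := by
  simp [hS.map_add s t hs ht]

theorem apply_comm (hS : IsC0Semigroup S) {s t : ℝ} (hs : 0 ≤ s) (ht : 0 ≤ t) (x : X) :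
    S s (S t x) = S t (S s x) := by
  rw [← hS.apply_add hs ht, ← hS.apply_add ht hs, add_comm]

/-- Otherwise there are times `t n → 0` with `‖S (t n)‖ > n`, while `S (t n) x → x` for each `x`,
against Banach–Steinhaus. -/
theorem exists_norm_le_near_zero [CompleteSpace X] (hS : IsC0Semigroup S) :
    ∃ δ > 0, ∃ C : ℝ, ∀ t ∈ Set.Icc 0 δ, ‖S t‖ ≤ C := by
  by_contra! H
  choose t ht hC using fun n : ℕ => H (1 / (n + 1)) (by positivity) n
  have ht0 : Tendsto t atTop (𝓝 0) :=
    squeeze_zero (fun n => (ht n).1) (fun n => (ht n).2) tendsto_one_div_add_atTop_nhds_zero_nat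
  have hcont : ∀ x, Tendsto (fun s => S s x) (𝓝[≥] 0) (𝓝 x) := fun x => by
    rw [← Set.Ioi_insert, nhdsWithin_insert, tendsto_sup]
    refine ⟨?_, hS.tendsto_zero x⟩
    rw [tendsto_pure_left]
    intro s hs
    rw [hS.apply_zero]
    exact mem_of_mem_nhds hs
  obtain ⟨C, hCb⟩ := banach_steinhaus (g := fun n => S (t n)) fun x => by
    have h1 : Tendsto (fun n => S (t n) x) atTop (𝓝 x) :=
      (hcont x).comp (tendsto_nhdsWithin_iff.2 ⟨ht0, Eventually.of_forall fun n => (ht n).1⟩)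
    obtain ⟨C, hC⟩ := h1.norm.bddAbove_range
    exact ⟨C, fun n => hC ⟨n, rfl⟩⟩
  obtain ⟨n, hn⟩ := exists_nat_gt C
  linarith [hC n, hCb n]

theorem exists_norm_le_Icc [CompleteSpace X] (hS : IsC0Semigroup S) (T : ℝ) :
    ∃ M : ℝ, ∀ t ∈ Set.Icc 0 T, ‖S t‖ ≤ M := by
  obtain ⟨δ, hδ, C, hC⟩ := hS.exists_norm_le_near_zero
  have key : ∀ n : ℕ, ∃ M : ℝ, ∀ t ∈ Set.Icc 0 (n * δ), ‖S t‖ ≤ M := by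
    intro n
    induction n with
    | zero =>
      refine ⟨‖S 0‖, fun t ht => ?_⟩
      have : t = 0 := le_antisymm (by simpa using ht.2) ht.1
      rw [this]
    | succ n ih =>
      obtain ⟨M, hM⟩ := ih
      refine ⟨max M (C * M), fun t ht => ?_⟩
      rcases le_total t (n * δ) with h | h
      · exact (hM t ⟨ht.1, h⟩).trans (le_max_left _ _)
      · have h0 : 0 ≤ (n : ℝ) * δ := by positivity
        have h2 := ht.2
        push_cast at h2
        have h3 : t = (t - n * δ) + n * δ := by ring
        have h4 := hC (t - n * δ) ⟨by linarith, by linarith⟩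
        rw [h3, hS.map_add _ _ (by linarith) h0]
        refine ((ContinuousLinearMap.opNorm_comp_le _ _).trans ?_).trans (le_max_right _ _)
        exact mul_le_mul h4 (hM _ ⟨h0, le_rfl⟩) (norm_nonneg _) ((norm_nonneg _).trans h4)
  obtain ⟨n, hn⟩ := exists_nat_ge (T / δ)
  obtain ⟨M, hM⟩ := key n
  exact ⟨M, fun t ht => hM t ⟨ht.1, ht.2.trans ((div_le_iff₀ hδ).1 hn)⟩⟩

theorem continuousOn_Icc [CompleteSpace X] (hS : IsC0Semigroup S) (x : X) (T : ℝ) :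
    ContinuousOn (fun t => S t x) (Set.Icc 0 T) := by
  obtain ⟨M, hM⟩ := hS.exists_norm_le_Icc T
  -- Factoring out the operator at the earlier time reduces both left and right continuity at `s` to
  -- right continuity at `0`.
  have key : ∀ s ∈ Set.Icc 0 T, ∀ t ∈ Set.Icc 0 T, s ≤ t →
      ‖S t x - S s x‖ ≤ M * ‖S |t - s| x - x‖ := by
    intro s hs t ht hst
    have h0 : 0 ≤ t - s := by linarith
    rw [abs_of_nonneg h0]
    have h1 : S t x = S s (S (t - s) x) := by rw [← hS.apply_add hs.1 h0]; congr 2; ring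
    rw [h1, ← map_sub]
    exact (S s).le_of_opNorm_le (hM s hs) _
  have habs : Tendsto (fun h : ℝ => S |h| x) (𝓝 0) (𝓝 x) := by
    rw [← nhdsNE_sup_pure, tendsto_sup]
    refine ⟨(hS.tendsto_zero x).comp ?_, ?_⟩
    · refine tendsto_nhdsWithin_iff.2 ⟨?_, ?_⟩
      · exact (continuous_abs.tendsto' (0 : ℝ) 0 abs_zero).mono_left nhdsWithin_le_nhds
      · filter_upwards [self_mem_nhdsWithin] with h hh
        exact abs_pos.2 hh
    · rw [tendsto_pure_left]
      intro s hs
      rw [abs_zero, hS.apply_zero]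
      exact mem_of_mem_nhds hs
  intro s hs
  have h1 : Tendsto (fun t => M * ‖S |t - s| x - x‖) (𝓝[Set.Icc 0 T] s) (𝓝 0) := by
    have h2 : Tendsto (fun t : ℝ => t - s) (𝓝[Set.Icc 0 T] s) (𝓝 0) :=
      ((continuous_id.sub continuous_const).tendsto' s 0 (sub_self s)).mono_left
        nhdsWithin_le_nhds
    simpa using ((habs.comp h2).sub_const x).norm.const_mul M
  refine tendsto_iff_norm_sub_tendsto_zero.2 (squeeze_zero' ?_ ?_ h1)
  · exact Eventually.of_forall fun _ => norm_nonneg _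
  · filter_upwards [self_mem_nhdsWithin] with t ht
    rcases le_total s t with h | h
    · exact key s hs t ht h
    · rw [norm_sub_rev, abs_sub_comm]
      exact key t ht s hs h

theorem continuousOn_Ici [CompleteSpace X] (hS : IsC0Semigroup S) (x : X) :
    ContinuousOn (fun t => S t x) (Set.Ici 0) := by
  intro t ht
  have h := hS.continuousOn_Icc x (t + 1) t ⟨ht, by linarith⟩
  refine h.mono_of_mem_nhdsWithin ?_
  rw [← Set.Ici_inter_Iic]
  exact inter_mem self_mem_nhdsWithin (mem_nhdsWithin_of_mem_nhds (Iic_mem_nhds (by linarith)))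

theorem apply_mem_graph (hS : IsC0Semigroup S) {x y : X} (h : (x, y) ∈ (generator S).graph)
    {t : ℝ} (ht : 0 ≤ t) : (S t x, S t y) ∈ (generator S).graph := by
  rw [mem_generator_graph] at h ⊢
  refine (((S t).continuous.tendsto y).comp h).congr' ?_
  filter_upwards [self_mem_nhdsWithin] with s hs
  rw [Function.comp_apply, map_smul, map_sub, hS.apply_comm ht (le_of_lt hs)]

end IsC0Semigroup

theorem tendsto_inv_smul_integral [CompleteSpace X] {f : ℝ → X} (hf : ContinuousOn f (Set.Ici 0))
    {a : ℝ} (ha : 0 ≤ a) :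
    Tendsto (fun h : ℝ => h⁻¹ • ∫ s in a..a + h, f s) (𝓝[>] 0) (𝓝 (f a)) := by
  -- Values at negative times are arbitrary; freezing `f` there gives a continuous function on the
  -- line, to which the fundamental theorem of calculus applies.
  have hg : Continuous fun t : ℝ => f (max t 0) :=
    hf.comp_continuous (by fun_prop) fun t => le_max_right t 0
  have hd := (hg.integral_hasStrictDerivAt a a).hasDerivAt
  rw [hasDerivAt_iff_tendsto_slope_zero, max_eq_left ha] at hd
  refine (hd.mono_left (nhdsWithin_mono _ fun h hh => ne_of_gt hh)).congr' ?_
  filter_upwards [self_mem_nhdsWithin] with h hh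
  rw [intervalIntegral.integral_same, sub_zero]
  congr 1
  refine intervalIntegral.integral_congr fun s hs => ?_
  rw [Set.uIcc_of_le (by linarith [Set.mem_Ioi.1 hh])] at hs
  simp only [max_eq_left (ha.trans hs.1)]

/-- Applying `S h` shifts the interval of integration, so the increment is the integral over `[t, t
+ h]` minus that over `[0, h]`. -/
theorem IsC0Semigroup.integral_mem_graph [CompleteSpace X] {S : ℝ → X →L[ℝ] X}
    (hS : IsC0Semigroup S) (x : X) {t : ℝ} (ht : 0 ≤ t) :
    (∫ s in (0 : ℝ)..t, S s x, S t x - x) ∈ (generator S).graph := by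
  rw [mem_generator_graph]
  have hc := hS.continuousOn_Ici x
  have h1 := (tendsto_inv_smul_integral hc ht).sub (tendsto_inv_smul_integral hc le_rfl)
  simp only [hS.apply_zero, zero_add] at h1
  refine h1.congr' ?_
  filter_upwards [self_mem_nhdsWithin] with h hh
  have hh0 : 0 ≤ h := le_of_lt hh
  have hI : ∀ {a b : ℝ}, 0 ≤ a → 0 ≤ b →
      IntervalIntegrable (fun s => S s x) MeasureTheory.volume a b := fun ha hb =>
    intervalIntegrable_of_continuousOn_Ici hc ha hb
  have h2 : S h (∫ s in (0 : ℝ)..t, S s x) = ∫ s in h..t + h, S s x := by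
    rw [← (S h).intervalIntegral_comp_comm (hI le_rfl ht)]
    have h3 := intervalIntegral.integral_comp_add_right (a := 0) (b := t) (fun s => S s x) h
    rw [zero_add] at h3
    rw [← h3]
    refine intervalIntegral.integral_congr fun s hs => ?_
    rw [Set.uIcc_of_le ht] at hs
    change S h (S s x) = S (s + h) x
    rw [add_comm, hS.apply_add hh0 hs.1]
  rw [h2, ← smul_sub]
  congr 1
  rw [sub_eq_sub_iff_add_eq_add, add_comm, add_comm (∫ s in h..t + h, S s x),
    intervalIntegral.integral_add_adjacent_intervals (hI le_rfl ht) (hI ht (by linarith)),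
    intervalIntegral.integral_add_adjacent_intervals (hI le_rfl hh0) (hI hh0 (by linarith))]

end Semigroup

/-! ### The resolvent of a bounded semigroup as its Laplace transform -/

section Laplace

open MeasureTheory

variable {X : Type*} [NormedAddCommGroup X] [NormedSpace ℝ X]
  {S : ℝ → X →L[ℝ] X}

namespace IsC0Semigroup

theorem norm_laplaceIntegrand_le {M : ℝ} (hM : ∀ t, 0 ≤ t → ‖S t‖ ≤ M) (l : ℝ) (x : X)
    {t : ℝ} (ht : 0 ≤ t) : ‖Real.exp (-l * t) • S t x‖ ≤ M * ‖x‖ * Real.exp (-l * t) := by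
  rw [norm_smul, Real.norm_of_nonneg (Real.exp_pos _).le, mul_comm]
  exact mul_le_mul_of_nonneg_right ((S t).le_of_opNorm_le (hM t ht) x) (Real.exp_pos _).le

variable [CompleteSpace X]

theorem continuousOn_laplaceIntegrand (hS : IsC0Semigroup S) (l : ℝ) (x : X) :
    ContinuousOn (fun t : ℝ => Real.exp (-l * t) • S t x) (Set.Ici 0) :=
  ContinuousOn.smul (by fun_prop) (hS.continuousOn_Ici x)

theorem integrableOn_laplaceIntegrand (hS : IsC0Semigroup S) {M : ℝ}
    (hM : ∀ t, 0 ≤ t → ‖S t‖ ≤ M) {l : ℝ} (hl : 0 < l) (x : X) :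
    IntegrableOn (fun t : ℝ => Real.exp (-l * t) • S t x) (Set.Ioi 0) := by
  refine Integrable.mono' ((exp_neg_integrableOn_Ioi 0 hl).const_mul (M * ‖x‖)) ?_ ?_
  · exact ((hS.continuousOn_laplaceIntegrand l x).mono
      Set.Ioi_subset_Ici_self).aestronglyMeasurable measurableSet_Ioi
  · refine (ae_restrict_mem measurableSet_Ioi).mono fun t ht => ?_
    exact norm_laplaceIntegrand_le hM l x (le_of_lt ht)

/-- The Laplace transform of a bounded strongly continuous semigroup. -/
noncomputable def laplace (hS : IsC0Semigroup S) {M : ℝ} (hM : ∀ t, 0 ≤ t → ‖S t‖ ≤ M) {l : ℝ}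
    (hl : 0 < l) : X →L[ℝ] X :=
  LinearMap.mkContinuous
    { toFun := fun x => ∫ t in Set.Ioi (0 : ℝ), Real.exp (-l * t) • S t x
      map_add' := fun x y => by
        simp only [_root_.map_add, smul_add]
        exact integral_add (hS.integrableOn_laplaceIntegrand hM hl x)
          (hS.integrableOn_laplaceIntegrand hM hl y)
      map_smul' := fun c x => by
        rw [RingHom.id_apply, ← integral_smul]
        refine integral_congr_ae (Eventually.of_forall fun t => ?_)
        dsimp only
        rw [map_smul, smul_comm] }
    (M * ∫ t in Set.Ioi (0 : ℝ), Real.exp (-l * t)) fun x => by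
      rw [mul_right_comm, ← integral_const_mul]
      refine norm_integral_le_of_norm_le ((exp_neg_integrableOn_Ioi 0 hl).const_mul _) ?_
      refine (ae_restrict_mem measurableSet_Ioi).mono fun t ht => ?_
      exact norm_laplaceIntegrand_le hM l x (le_of_lt ht)

theorem laplace_apply (hS : IsC0Semigroup S) {M : ℝ} (hM : ∀ t, 0 ≤ t → ‖S t‖ ≤ M) {l : ℝ}
    (hl : 0 < l) (x : X) :
    hS.laplace hM hl x = ∫ t in Set.Ioi (0 : ℝ), Real.exp (-l * t) • S t x := rfl

theorem apply_laplace (hS : IsC0Semigroup S) {M : ℝ} (hM : ∀ t, 0 ≤ t → ‖S t‖ ≤ M) {l : ℝ}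
    (hl : 0 < l) {h : ℝ} (hh : 0 ≤ h) (x : X) :
    S h (hS.laplace hM hl x) = hS.laplace hM hl (S h x) := by
  rw [laplace_apply, laplace_apply, ← ContinuousLinearMap.integral_comp_comm _
    (hS.integrableOn_laplaceIntegrand hM hl x)]
  refine setIntegral_congr_fun measurableSet_Ioi fun t ht => ?_
  simp only [map_smul]
  rw [hS.apply_comm hh (le_of_lt ht)]

theorem laplace_apply_semigroup (hS : IsC0Semigroup S) {M : ℝ} (hM : ∀ t, 0 ≤ t → ‖S t‖ ≤ M)
    {l : ℝ} (hl : 0 < l) {h : ℝ} (hh : 0 ≤ h) (x : X) :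
    hS.laplace hM hl (S h x) = Real.exp (l * h) • (hS.laplace hM hl x -
      ∫ t in (0 : ℝ)..h, Real.exp (-l * t) • S t x) := by
  set F : ℝ → X := fun t => Real.exp (-l * t) • S t x with hF
  have h1 : hS.laplace hM hl (S h x) = ∫ t in Set.Ioi (0 : ℝ), Real.exp (l * h) • F (t + h) := by
    rw [laplace_apply]
    refine setIntegral_congr_fun measurableSet_Ioi fun t ht => ?_
    simp only [hF, smul_smul, ← Real.exp_add]
    rw [hS.apply_add (le_of_lt ht) hh]
    congr 2
    ring
  have h2 : ∫ t in Set.Ioi (0 : ℝ), F (t + h) = ∫ t in Set.Ioi h, F t := by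
    have := (measurePreserving_add_right volume h).setIntegral_preimage_emb
      (MeasurableEquiv.addRight h).measurableEmbedding F (Set.Ioi h)
    simpa using this
  rw [h1, integral_smul, h2, laplace_apply,
    ← intervalIntegral.integral_Ioi_sub_Ioi (hS.integrableOn_laplaceIntegrand hM hl x) hh,
    sub_sub_cancel]

theorem laplace_mem_graph (hS : IsC0Semigroup S) {M : ℝ} (hM : ∀ t, 0 ≤ t → ‖S t‖ ≤ M)
    {l : ℝ} (hl : 0 < l) (x : X) :
    (hS.laplace hM hl x, l • hS.laplace hM hl x - x) ∈ (generator S).graph := by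
  rw [mem_generator_graph]
  have h1 := tendsto_inv_smul_integral (hS.continuousOn_laplaceIntegrand l x) le_rfl
  simp only [zero_add, hS.apply_zero, mul_zero, Real.exp_zero, one_smul] at h1
  have h2 : HasDerivAt (fun t : ℝ => Real.exp (l * t)) l 0 := by
    simpa using ((hasDerivAt_id (0 : ℝ)).const_mul l).exp
  have h3 : Tendsto (fun t : ℝ => Real.exp (l * t)) (𝓝[>] 0) (𝓝 1) :=
    (h2.continuousAt.tendsto.mono_left nhdsWithin_le_nhds).trans (by simp)
  rw [hasDerivAt_iff_tendsto_slope_zero] at h2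
  have h4 := h2.mono_left (nhdsWithin_mono (0 : ℝ) fun h (hh : h ∈ Set.Ioi 0) => ne_of_gt hh)
  -- By `laplace_apply_semigroup`, the difference quotient is that of `exp (l h)` times the
  -- transform, minus `exp (l h)` times the mean of the integrand over `[0, h]`.
  have h5 := (h4.smul_const (hS.laplace hM hl x)).sub (h3.smul h1)
  rw [one_smul] at h5
  refine h5.congr' ?_
  filter_upwards [self_mem_nhdsWithin] with h hh
  rw [hS.apply_laplace hM hl (le_of_lt hh), hS.laplace_apply_semigroup hM hl (le_of_lt hh)]
  simp only [zero_add, mul_zero, Real.exp_zero, smul_eq_mul]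
  module

theorem isResolvent_laplace (hS : IsC0Semigroup S) {M : ℝ} (hM : ∀ t, 0 ≤ t → ‖S t‖ ≤ M)
    {l : ℝ} (hl : 0 < l) : IsResolvent (generator S) l (hS.laplace hM hl) := by
  constructor
  · intro x
    obtain ⟨z, hz, hz'⟩ := (LinearPMap.mem_graph_iff _).1 (hS.laplace_mem_graph hM hl x)
    dsimp only at hz hz'
    refine ⟨hz ▸ z.2, ?_⟩
    have : (⟨hS.laplace hM hl x, hz ▸ z.2⟩ : (generator S).domain) = z := Subtype.ext hz.symm
    rw [this, hz', sub_sub_cancel]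
  · intro u
    have h1 := (mem_generator_graph S _ _).1 ((generator S).mem_graph u)
    have h2 := ((hS.laplace hM hl).continuous.tendsto _).comp h1
    have h3 := (mem_generator_graph S _ _).1 (hS.laplace_mem_graph hM hl (u : X))
    -- The transform commutes with `S h`, hence carries difference quotients of `u` to those of its
    -- image.
    have h4 : hS.laplace hM hl (generator S u) = l • hS.laplace hM hl u - u := by
      refine tendsto_nhds_unique (h2.congr' ?_) h3
      filter_upwards [self_mem_nhdsWithin] with h hh
      rw [Function.comp_apply, map_smul, map_sub, hS.apply_laplace hM hl (le_of_lt hh)]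
    rw [map_sub, map_smul, h4, sub_sub_cancel]

end IsC0Semigroup

end Laplace

/-! ### Substochasticity and the sign of the mass under the generator -/

section SubstochasticSemigroup

open MeasureTheory

variable {X : Type*} [NormedAddCommGroup X] [NormedSpace ℝ X] [PartialOrder X]
  [AbstractStateSpace X] {S : ℝ → X →L[ℝ] X}

theorem IsC0Semigroup.isResolvent_resolventOp (hS : IsC0Semigroup S)
    (hsub : ∀ t, 0 ≤ t → IsSubstochastic (S t)) {l : ℝ} (hl : 0 < l) :
    IsResolvent (generator S) l (resolventOp (generator S) l) ∧
      IsPositiveOp (resolventOp (generator S) l) := by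
  obtain ⟨M, -, hM⟩ := exists_norm_le_of_norm_le_of_nonneg X
  have hM' : ∀ t, 0 ≤ t → ‖S t‖ ≤ M := fun t ht => hM _ (hsub t ht).2
  have h := hS.isResolvent_laplace hM' hl
  rw [h.resolventOp_eq]
  refine ⟨h, fun u hu => ?_⟩
  rw [hS.laplace_apply]
  refine integral_nonneg_of_ae ((ae_restrict_mem measurableSet_Ioi).mono fun t ht => ?_)
  exact smul_nonneg (Real.exp_pos _).le ((hsub t (le_of_lt ht)).1 u hu)

theorem integral_nonneg_of_isPositiveOp (hpos : ∀ t, 0 ≤ t → IsPositiveOp (S t)) {u : X}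
    (hu : 0 ≤ u) {t : ℝ} (ht : 0 ≤ t) : 0 ≤ ∫ s in (0 : ℝ)..t, S s u := by
  rw [intervalIntegral.integral_of_le ht]
  refine integral_nonneg_of_ae ((ae_restrict_mem measurableSet_Ioc).mono fun s hs => ?_)
  exact hpos s (le_of_lt hs.1) u hu

theorem massFunctional_nonpos_of_mem_graph (hsub : ∀ t, 0 ≤ t → IsSubstochastic (S t)) {u y : X}
    (hu : 0 ≤ u) (h : (u, y) ∈ (generator S).graph) : massFunctional X y ≤ 0 := by
  rw [mem_generator_graph] at h
  refine le_of_tendsto ((continuous_massFunctional.tendsto y).comp h) ?_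
  filter_upwards [self_mem_nhdsWithin] with t ht
  have ht0 : 0 ≤ t := le_of_lt ht
  rw [Function.comp_apply, map_smul, map_sub, massFunctional_of_nonneg hu,
    massFunctional_of_nonneg ((hsub t ht0).1 u hu), smul_eq_mul]
  exact mul_nonpos_of_nonneg_of_nonpos (by positivity) (by linarith [(hsub t ht0).2 u hu])

/-- A positive semigroup whose generator is mass-dissipative is substochastic. -/
theorem IsC0Semigroup.isSubstochastic_of_massFunctional_nonpos (hS : IsC0Semigroup S)
    (hpos : ∀ t, 0 ≤ t → IsPositiveOp (S t))
    (hmass : ∀ u y : X, 0 ≤ u → (u, y) ∈ (generator S).graph → massFunctional X y ≤ 0)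
    {t : ℝ} (ht : 0 ≤ t) : IsSubstochastic (S t) := by
  refine ⟨hpos t ht, ?_⟩
  have key : ∀ u y : X, 0 ≤ u → (u, y) ∈ (generator S).graph → ‖S t u‖ ≤ ‖u‖ := by
    intro u y hu hy
    -- For `u` in the domain, the mass of the orbit has right derivative `Ψ (S s y) ≤ 0`, so it
    -- cannot grow.
    have h := image_le_of_liminf_slope_right_le_deriv_boundary
      (f := fun s => massFunctional X (S s u)) (a := 0) (b := t) (B := fun _ => massFunctional X u)
      (B' := fun _ => 0)
      (continuous_massFunctional.comp_continuousOn (hS.continuousOn_Icc u t))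
      (by rw [hS.apply_zero]) continuousOn_const (fun _ _ => hasDerivWithinAt_const _ _ _)
      (fun s hs r hr => by
        have h1 := (mem_generator_graph S _ _).1 (hS.apply_mem_graph hy hs.1)
        have h2 : Tendsto (fun z : ℝ => z - s) (𝓝[>] s) (𝓝[>] 0) := by
          refine tendsto_nhdsWithin_iff.2 ⟨?_, ?_⟩
          · exact ((continuous_id.sub continuous_const).tendsto' s 0 (sub_self s)).mono_left
              nhdsWithin_le_nhds
          · filter_upwards [self_mem_nhdsWithin] with z hz
            exact Set.mem_Ioi.2 (sub_pos.2 (Set.mem_Ioi.1 hz))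
        have h3 := ((continuous_massFunctional.tendsto _).comp h1).comp h2
        have h4 := hmass _ _ (hpos s hs.1 u hu) (hS.apply_mem_graph hy hs.1)
        refine Eventually.frequently ?_
        filter_upwards [h3.eventually_lt_const (h4.trans_lt hr), self_mem_nhdsWithin] with z hz hz'
        have hz0 : 0 ≤ z - s := sub_nonneg.2 (le_of_lt hz')
        rw [Function.comp_apply, Function.comp_apply, ← hS.apply_add hz0 hs.1, sub_add_cancel,
          map_smul, map_sub] at hz
        exact hz) (x := t) ⟨ht, le_rfl⟩
    rwa [massFunctional_of_nonneg (hpos t ht u hu), massFunctional_of_nonneg hu] at h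
  intro u hu
  -- A general `u ≥ 0` is the limit of its orbit averages, which are positive and lie in the domain.
  have h1 := tendsto_inv_smul_integral (hS.continuousOn_Ici u) le_rfl
  simp only [zero_add, hS.apply_zero] at h1
  refine le_of_tendsto_of_tendsto (((S t).continuous.tendsto u).comp h1).norm h1.norm ?_
  filter_upwards [self_mem_nhdsWithin] with h hh
  have hh0 : 0 ≤ h := le_of_lt hh
  exact key _ (h⁻¹ • (S h u - u))
    (smul_nonneg (by positivity) (integral_nonneg_of_isPositiveOp hpos hu hh0))
    ((generator S).graph.smul_mem h⁻¹ (hS.integral_mem_graph u hh0))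

end SubstochasticSemigroup

/-! ### Kato's conditions for `A - K` -/

section Perturbation

variable {X : Type*} [NormedAddCommGroup X] [NormedSpace ℝ X]

theorem mem_graph_of_mem_graph_subBounded {A : X →ₗ.[ℝ] X} {K : X →L[ℝ] X} {u y : X}
    (h : (u, y) ∈ (subBounded A K).graph) : (u, y + K u) ∈ A.graph := by
  obtain ⟨z, hz, hz'⟩ := (LinearPMap.mem_graph_iff _).1 h
  dsimp only at hz hz'
  have hzA : (z : X) ∈ A.domain := by
    rw [← subBounded_domain A K]
    exact z.2
  refine (LinearPMap.mem_graph_iff _).2 ⟨⟨z, hzA⟩, hz, ?_⟩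
  have : subBounded A K z = A ⟨z, hzA⟩ - K z :=
    LinearPMap.sub_apply A ((K : X →ₗ[ℝ] X).toPMap ⊤) z
  rw [← hz', this, ← hz]
  simp

variable [PartialOrder X] [AbstractStateSpace X]

theorem KatoConditions.massFunctional_le {A B : X →ₗ.[ℝ] X} (h : KatoConditions A B) {u y : X}
    (hu : 0 ≤ u) (hy : (u, y) ∈ A.graph) : massFunctional X (y + valueAt B u) ≤ 0 := by
  obtain ⟨z, rfl, rfl⟩ := (LinearPMap.mem_graph_iff _).1 hy
  have := h.mass_nonpos z hu
  rwa [← valueAt_of_mem B ⟨z, h.domain_le z.2⟩] at this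

/-- On the cone, subtracting `K` only lowers mass, as `Ψ (K u) = ‖K u‖ ≥ 0`. Thus both `Ψ ((A - K)
u) ≤ 0`, which makes the given positive semigroup substochastic, and the mass condition follow from
those for `A`. -/
theorem KatoConditions.subBounded {A B : X →ₗ.[ℝ] X} (h : KatoConditions A B) {K : X →L[ℝ] X}
    (hK : IsPositiveOp K) (hAK : ∃ U : ℝ → X →L[ℝ] X, IsC0Semigroup U ∧
      generator U = subBounded A K ∧ ∀ t : ℝ, 0 ≤ t → IsPositiveOp (U t)) :
    KatoConditions (subBounded A K) B where
  domain_le := by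
    rw [subBounded_domain]
    exact h.domain_le
  generates := by
    obtain ⟨U, hU, hUA, hpos⟩ := hAK
    refine ⟨U, hU, fun t ht => ?_, hUA⟩
    refine hU.isSubstochastic_of_massFunctional_nonpos hpos (fun u y hu hy => ?_) ht
    obtain ⟨T, -, hT, rfl⟩ := h.generates
    · rw [hUA] at hy
      have h1 := massFunctional_nonpos_of_mem_graph hT hu (mem_graph_of_mem_graph_subBounded hy)
      rw [map_add, massFunctional_of_nonneg (hK u hu)] at h1
      linarith [norm_nonneg (K u)]
  nonneg u hu := h.nonneg ⟨u, by rw [← subBounded_domain A K]; exact u.2⟩ hu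
  mass_nonpos u hu := by
    have h1 := h.massFunctional_le hu
      (mem_graph_of_mem_graph_subBounded ((Kato.subBounded A K).mem_graph u))
    have hB : (u : X) ∈ B.domain := h.domain_le (by rw [← subBounded_domain A K]; exact u.2)
    rw [valueAt_of_mem B ⟨u, hB⟩, add_right_comm, map_add,
      massFunctional_of_nonneg (hK u hu)] at h1
    linarith [norm_nonneg (K u)]

end Perturbation

/-! ### Honesty as decay of the iterates of `B R(l, A)` -/

section Honesty

variable {X : Type*} [NormedAddCommGroup X] [NormedSpace ℝ X]

theorem IsResolvent.apply_mem_graph {A : X →ₗ.[ℝ] X} {l : ℝ} {R : X →L[ℝ] X}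
    (h : IsResolvent A l R) (x : X) : (R x, l • R x - x) ∈ A.graph := by
  obtain ⟨hx, e⟩ := h.1 x
  refine (LinearPMap.mem_graph_iff _).2 ⟨⟨R x, hx⟩, rfl, ?_⟩
  exact eq_sub_of_add_eq' (sub_eq_iff_eq_add.1 e).symm

theorem IsResolvent.apply_smul_sub {A : X →ₗ.[ℝ] X} {l : ℝ} {R : X →L[ℝ] X}
    (h : IsResolvent A l R) {u y : X} (hy : (u, y) ∈ A.graph) : R (l • u - y) = u := by
  obtain ⟨z, rfl, rfl⟩ := (LinearPMap.mem_graph_iff _).1 hy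
  exact h.2 z

theorem valueAt_add {T : X →ₗ.[ℝ] X} {x y : X} (hx : x ∈ T.domain) (hy : y ∈ T.domain) :
    valueAt T (x + y) = valueAt T x + valueAt T y := by
  rw [valueAt_of_mem T ⟨x, hx⟩, valueAt_of_mem T ⟨y, hy⟩, ← LinearPMap.map_add, ← valueAt_of_mem]
  rfl

theorem valueAt_smul {T : X →ₗ.[ℝ] X} {x : X} (c : ℝ) (hx : x ∈ T.domain) :
    valueAt T (c • x) = c • valueAt T x := by
  rw [valueAt_of_mem T ⟨x, hx⟩, ← LinearPMap.map_smul, ← valueAt_of_mem]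
  rfl

variable [PartialOrder X] [AbstractStateSpace X] {A B : X →ₗ.[ℝ] X}

namespace KatoConditions

theorem isResolvent (h : KatoConditions A B) {l : ℝ} (hl : 0 < l) :
    IsResolvent A l (resolventOp A l) := by
  obtain ⟨U, hU, hsub, rfl⟩ := h.generates
  exact (hU.isResolvent_resolventOp hsub hl).1

theorem isPositiveOp_resolventOp (h : KatoConditions A B) {l : ℝ} (hl : 0 < l) :
    IsPositiveOp (resolventOp A l) := by
  obtain ⟨U, hU, hsub, rfl⟩ := h.generates
  exact (hU.isResolvent_resolventOp hsub hl).2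

theorem resolventOp_mem_domain (h : KatoConditions A B) {l : ℝ} (hl : 0 < l) (x : X) :
    resolventOp A l x ∈ B.domain :=
  h.domain_le ((h.isResolvent hl).1 x).1

/-- The linear operator `B R(l, A)`. -/
noncomputable def linBR (h : KatoConditions A B) {l : ℝ} (hl : 0 < l) : X →ₗ[ℝ] X where
  toFun := BR A B l
  map_add' x y := by
    unfold BR
    rw [map_add, valueAt_add (h.resolventOp_mem_domain hl x) (h.resolventOp_mem_domain hl y)]
  map_smul' c x := by
    unfold BR
    rw [map_smul, valueAt_smul c (h.resolventOp_mem_domain hl x), RingHom.id_apply]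

theorem linBR_apply (h : KatoConditions A B) {l : ℝ} (hl : 0 < l) (x : X) :
    h.linBR hl x = valueAt B (resolventOp A l x) := rfl

theorem iterate_BR (h : KatoConditions A B) {l : ℝ} (hl : 0 < l) (n : ℕ) (x : X) :
    (BR A B l)^[n] x = (h.linBR hl ^ n) x := by
  rw [Module.End.pow_apply]
  rfl

theorem linBR_nonneg (h : KatoConditions A B) {l : ℝ} (hl : 0 < l) {x : X} (hx : 0 ≤ x) :
    0 ≤ h.linBR hl x := by
  have hd := ((h.isResolvent hl).1 x).1
  rw [linBR_apply, valueAt_of_mem B ⟨_, h.domain_le hd⟩]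
  exact h.nonneg ⟨_, hd⟩ (h.isPositiveOp_resolventOp hl x hx)

theorem linBR_pow_nonneg (h : KatoConditions A B) {l : ℝ} (hl : 0 < l) (n : ℕ) {x : X}
    (hx : 0 ≤ x) : 0 ≤ (h.linBR hl ^ n) x := by
  induction n with
  | zero => simpa using hx
  | succ n ih =>
    rw [pow_succ', Module.End.mul_apply]
    exact h.linBR_nonneg hl ih

/-- This is the mass condition at `R x`, where `A R x = l R x - x`. -/
theorem norm_linBR_add_le (h : KatoConditions A B) {l : ℝ} (hl : 0 < l) {x : X} (hx : 0 ≤ x) :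
    ‖h.linBR hl x‖ + l * ‖resolventOp A l x‖ ≤ ‖x‖ := by
  have hR := h.isPositiveOp_resolventOp hl x hx
  have h1 := h.massFunctional_le hR ((h.isResolvent hl).apply_mem_graph x)
  rw [← h.linBR_apply hl, map_add, map_sub, map_smul, massFunctional_of_nonneg hR,
    massFunctional_of_nonneg hx, massFunctional_of_nonneg (h.linBR_nonneg hl hx),
    smul_eq_mul] at h1
  linarith

theorem norm_linBR_le (h : KatoConditions A B) {l : ℝ} (hl : 0 < l) {x : X} (hx : 0 ≤ x) :
    ‖h.linBR hl x‖ ≤ ‖x‖ := by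
  have := h.norm_linBR_add_le hl hx
  have : 0 ≤ l * ‖resolventOp A l x‖ := by positivity
  linarith

theorem antitone_norm_linBR_pow (h : KatoConditions A B) {l : ℝ} (hl : 0 < l) {x : X}
    (hx : 0 ≤ x) : Antitone fun n => ‖(h.linBR hl ^ n) x‖ := by
  refine antitone_nat_of_succ_le fun n => ?_
  rw [pow_succ', Module.End.mul_apply]
  exact h.norm_linBR_le hl (h.linBR_pow_nonneg hl n hx)

theorem norm_linBR_pow_le (h : KatoConditions A B) {l : ℝ} (hl : 0 < l) (n : ℕ) {x : X}
    (hx : 0 ≤ x) : ‖(h.linBR hl ^ n) x‖ ≤ ‖x‖ := by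
  simpa using h.antitone_norm_linBR_pow hl hx (Nat.zero_le n)

/-- Uniformity in `n` is what lets decay pass to limits of vectors in `tendsto_of_isHonest`. -/
theorem exists_abs_massFunctional_linBR_pow_le (h : KatoConditions A B) {l : ℝ} (hl : 0 < l) :
    ∃ C : ℝ, 0 < C ∧ ∀ (n : ℕ) (x : X), |massFunctional X ((h.linBR hl ^ n) x)| ≤ C * ‖x‖ := by
  obtain ⟨C, hC, hC'⟩ := abs_le_of_abs_le_norm_of_nonneg (X := X)
  refine ⟨C, hC, fun n => hC' (massFunctional X ∘ₗ h.linBR hl ^ n) fun u hu => ?_⟩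
  rw [LinearMap.comp_apply, massFunctional_of_nonneg (h.linBR_pow_nonneg hl n hu), abs_norm]
  exact h.norm_linBR_pow_le hl n hu

theorem lossA_seriesTerm (h : KatoConditions A B) {l : ℝ} (hl : 0 < l) (k : ℕ) (x : X) :
    lossA A B (seriesTerm A B l k x) = massFunctional X ((h.linBR hl ^ k) x) -
      massFunctional X ((h.linBR hl ^ (k + 1)) x) -
      l * massFunctional X (seriesTerm A B l k x) := by
  have h1 := valueAt_of_mem_graph ((h.isResolvent hl).apply_mem_graph ((BR A B l)^[k] x))
  unfold lossA seriesTerm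
  rw [h1, h.iterate_BR hl, ← h.linBR_apply hl, pow_succ', Module.End.mul_apply, map_add, map_sub,
    map_smul, smul_eq_mul]
  ring

theorem sum_lossA_seriesTerm (h : KatoConditions A B) {l : ℝ} (hl : 0 < l) (n : ℕ) (x : X) :
    ∑ k ∈ Finset.range n, lossA A B (seriesTerm A B l k x) = massFunctional X x -
      massFunctional X ((h.linBR hl ^ n) x) -
      l * massFunctional X (∑ k ∈ Finset.range n, seriesTerm A B l k x) := by
  simp only [h.lossA_seriesTerm hl]
  rw [Finset.sum_sub_distrib, Finset.sum_range_sub', map_sum, Finset.mul_sum]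
  simp

theorem seriesTerm_nonneg (h : KatoConditions A B) {l : ℝ} (hl : 0 < l) (k : ℕ) {x : X}
    (hx : 0 ≤ x) : 0 ≤ seriesTerm A B l k x := by
  unfold seriesTerm
  rw [h.iterate_BR hl]
  exact h.isPositiveOp_resolventOp hl _ (h.linBR_pow_nonneg hl k hx)

theorem seriesTerm_sub (h : KatoConditions A B) {l : ℝ} (hl : 0 < l) (k : ℕ) (x y : X) :
    seriesTerm A B l k (x - y) = seriesTerm A B l k x - seriesTerm A B l k y := by
  unfold seriesTerm
  simp only [h.iterate_BR hl, map_sub]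

theorem summable_lossA_seriesTerm (h : KatoConditions A B) {l : ℝ} (hl : 0 < l) (x : X) :
    Summable fun k => lossA A B (seriesTerm A B l k x) := by
  have key : ∀ p : X, 0 ≤ p → Summable fun k => lossA A B (seriesTerm A B l k p) := by
    intro p hp
    refine summable_of_sum_range_le (c := ‖p‖) (fun k => ?_) fun n => ?_
    · have h1 := h.norm_linBR_add_le hl (h.linBR_pow_nonneg hl k hp)
      rw [h.lossA_seriesTerm hl, massFunctional_of_nonneg (h.linBR_pow_nonneg hl _ hp),
        massFunctional_of_nonneg (h.linBR_pow_nonneg hl _ hp),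
        massFunctional_of_nonneg (h.seriesTerm_nonneg hl k hp), pow_succ', Module.End.mul_apply]
      unfold seriesTerm
      rw [h.iterate_BR hl]
      linarith
    · rw [h.sum_lossA_seriesTerm hl, massFunctional_of_nonneg hp,
        massFunctional_of_nonneg (h.linBR_pow_nonneg hl _ hp),
        massFunctional_of_nonneg (Finset.sum_nonneg fun k _ => h.seriesTerm_nonneg hl k hp)]
      have : 0 ≤ l * ‖∑ k ∈ Finset.range n, seriesTerm A B l k p‖ := by positivity
      linarith [norm_nonneg ((h.linBR hl ^ n) p)]
  obtain ⟨p, q, hp, hq, rfl⟩ := AbstractStateSpace.generating x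
  refine ((key p hp).sub (key q hq)).congr fun k => ?_
  rw [h.lossA_seriesTerm hl, h.lossA_seriesTerm hl, h.lossA_seriesTerm hl, h.seriesTerm_sub hl,
    map_sub, map_sub, map_sub, map_sub, map_sub]
  ring

end KatoConditions

namespace IsKatoSemigroup

variable {V : ℝ → X →L[ℝ] X}

/-- The mass lost in the limit by the iterates of `B R(l, A)` is the defect of `ā`. -/
theorem tendsto_massFunctional_linBR_pow (hV : IsKatoSemigroup A B V) (h : KatoConditions A B)
    {l : ℝ} (hl : 0 < l) {v y : X} (hv : (v, y) ∈ (generator V).graph) :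
    Tendsto (fun n => massFunctional X ((h.linBR hl ^ n) (l • v - y))) atTop
      (𝓝 (-massFunctional X y - lossBar A B (generator V) l v)) := by
  have hR := (hV.isC0Semigroup.isResolvent_resolventOp hV.substochastic hl).1
  have h1 := hV.resolvent_eq l hl (l • v - y)
  rw [hR.apply_smul_sub hv] at h1
  have h2 := (continuous_massFunctional.tendsto v).comp h1
  have h3 : Tendsto (fun n => ∑ k ∈ Finset.range n, lossA A B (seriesTerm A B l k (l • v - y)))
      atTop (𝓝 (lossBar A B (generator V) l v)) := by
    have := (h.summable_lossA_seriesTerm hl (l • v - y)).hasSum.tendsto_sum_nat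
    rwa [← valueAt_of_mem_graph hv] at this ⊢
  -- The resolvent series has its partial sums over `range (n + 1)`, so the telescoped identity is
  -- used at `n + 1`.
  rw [← tendsto_add_atTop_iff_nat 1]
  have h4 := ((h2.const_mul l).const_sub (massFunctional X (l • v - y))).sub
    ((tendsto_add_atTop_iff_nat 1).2 h3)
  have h5 : massFunctional X (l • v - y) - l * massFunctional X v = -massFunctional X y := by
    rw [map_sub, map_smul, smul_eq_mul]
    ring
  rw [h5] at h4
  refine h4.congr fun n => ?_
  rw [h.sum_lossA_seriesTerm hl, Function.comp_apply]
  ring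

theorem massFunctional_orbit_sub (hV : IsKatoSemigroup A B V) {t : ℝ} (ht : 0 ≤ t) {u : X}
    (hu : 0 ≤ u) : massFunctional X (V t u - u) = ‖V t u‖ - ‖u‖ := by
  rw [map_sub, massFunctional_of_nonneg hu,
    massFunctional_of_nonneg ((hV.substochastic t ht).1 u hu)]

theorem isHonest_of_tendsto (hV : IsKatoSemigroup A B V) (h : KatoConditions A B)
    (H : ∀ (l : ℝ) (hl : 0 < l) (u : X), 0 ≤ u →
      Tendsto (fun n => ‖(h.linBR hl ^ n) u‖) atTop (𝓝 0)) : IsHonest A B V := by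
  intro l hl t ht u hu
  have h1 := hV.tendsto_massFunctional_linBR_pow h hl (hV.isC0Semigroup.integral_mem_graph u ht)
  have h2 : ∀ x : X, Tendsto (fun n => massFunctional X ((h.linBR hl ^ n) x)) atTop (𝓝 0) := by
    intro x
    obtain ⟨p, q, hp, hq, rfl⟩ := AbstractStateSpace.generating x
    rw [← sub_zero (0 : ℝ)]
    refine ((H l hl p hp).sub (H l hl q hq)).congr fun n => ?_
    rw [map_sub, map_sub, massFunctional_of_nonneg (h.linBR_pow_nonneg hl n hp),
      massFunctional_of_nonneg (h.linBR_pow_nonneg hl n hq)]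
  have h3 := tendsto_nhds_unique h1 (h2 _)
  rw [hV.massFunctional_orbit_sub ht hu] at h3
  linarith

/-- Honesty gives the decay only at vectors `(l - G) ∫ V s f` with `f ≥ 0`. For `f = R(l, G) u`
their quotients by `t` tend to `(l - G) f = u`, and the uniform bound on the functionals carries the
decay over to `u`. -/
theorem tendsto_of_isHonest (hV : IsKatoSemigroup A B V) (h : KatoConditions A B)
    (hh : IsHonest A B V) {l : ℝ} (hl : 0 < l) {u : X} (hu : 0 ≤ u) :
    Tendsto (fun n => ‖(h.linBR hl ^ n) u‖) atTop (𝓝 0) := by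
  obtain ⟨hR, hRpos⟩ := hV.isC0Semigroup.isResolvent_resolventOp hV.substochastic hl
  set f := resolventOp (generator V) l u with hf
  have hf0 : 0 ≤ f := hRpos u hu
  set x : ℝ → X := fun t => t⁻¹ • (l • (∫ s in (0 : ℝ)..t, V s f) - (V t f - f)) with hx
  have hx0 : ∀ t, 0 < t → Tendsto (fun n => massFunctional X ((h.linBR hl ^ n) (x t))) atTop
      (𝓝 0) := by
    intro t ht
    have h1 := hV.tendsto_massFunctional_linBR_pow h hl
      (hV.isC0Semigroup.integral_mem_graph f ht.le)
    have h2 := hh l hl t ht.le f hf0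
    rw [hV.massFunctional_orbit_sub ht.le hf0, h2, neg_neg, sub_self] at h1
    simpa only [hx, map_smul, smul_zero] using h1.const_smul t⁻¹
  have hxu : Tendsto x (𝓝[>] 0) (𝓝 u) := by
    have h1 := tendsto_inv_smul_integral (hV.isC0Semigroup.continuousOn_Ici f) le_rfl
    have h2 := (mem_generator_graph V _ _).1 (hR.apply_mem_graph u)
    simp only [zero_add, hV.isC0Semigroup.apply_zero] at h1
    have h3 := (h1.const_smul l).sub h2
    rw [sub_sub_cancel] at h3
    refine h3.congr fun t => ?_
    rw [smul_comm l, ← smul_sub]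
  obtain ⟨C, hC, hCb⟩ := h.exists_abs_massFunctional_linBR_pow_le hl
  rw [Metric.tendsto_atTop]
  intro ε hε
  have hev := (hxu.eventually (Metric.ball_mem_nhds u (by positivity : 0 < ε / (2 * C)))).and
    self_mem_nhdsWithin
  obtain ⟨t, ht, ht0⟩ := hev.exists
  obtain ⟨N, hN⟩ := Metric.tendsto_atTop.1 (hx0 t ht0) (ε / 2) (by positivity)
  refine ⟨N, fun n hn => ?_⟩
  have h1 := hN n hn
  have h2 := hCb n (x t - u)
  rw [dist_eq_norm, lt_div_iff₀ (by positivity)] at ht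
  rw [map_sub, map_sub, massFunctional_of_nonneg (h.linBR_pow_nonneg hl n hu)] at h2
  rw [Real.dist_eq, sub_zero] at h1
  rw [Real.dist_eq, sub_zero, abs_norm]
  have h3 := abs_lt.1 h1
  have h4 := abs_le.1 h2
  linarith

end IsKatoSemigroup

end Honesty

/-! ### Comparing the limit masses for `A` and `A - K` -/

section Comparison

variable {X : Type*} [NormedAddCommGroup X] [NormedSpace ℝ X] [PartialOrder X]
  [AbstractStateSpace X] {A B : X →ₗ.[ℝ] X}

namespace KatoConditions

/-- The limit of `‖(B R(l, A))^n u‖`, for `u ≥ 0`. -/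
noncomputable def limitMass (h : KatoConditions A B) {l : ℝ} (hl : 0 < l) (u : X) : ℝ :=
  ⨅ n, ‖(h.linBR hl ^ n) u‖

theorem tendsto_limitMass (h : KatoConditions A B) {l : ℝ} (hl : 0 < l) {u : X} (hu : 0 ≤ u) :
    Tendsto (fun n => ‖(h.linBR hl ^ n) u‖) atTop (𝓝 (h.limitMass hl u)) :=
  tendsto_atTop_ciInf (h.antitone_norm_linBR_pow hl hu)
    ⟨0, by rintro _ ⟨n, rfl⟩; exact norm_nonneg _⟩

theorem limitMass_nonneg (h : KatoConditions A B) {l : ℝ} (hl : 0 < l) {u : X} (hu : 0 ≤ u) :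
    0 ≤ h.limitMass hl u :=
  ge_of_tendsto' (h.tendsto_limitMass hl hu) fun _ => norm_nonneg _

theorem limitMass_le_norm (h : KatoConditions A B) {l : ℝ} (hl : 0 < l) {u : X} (hu : 0 ≤ u) :
    h.limitMass hl u ≤ ‖u‖ :=
  le_of_tendsto' (h.tendsto_limitMass hl hu) fun n => h.norm_linBR_pow_le hl n hu

theorem limitMass_add (h : KatoConditions A B) {l : ℝ} (hl : 0 < l) {u v : X} (hu : 0 ≤ u)
    (hv : 0 ≤ v) : h.limitMass hl (u + v) = h.limitMass hl u + h.limitMass hl v := by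
  refine tendsto_nhds_unique (h.tendsto_limitMass hl (add_nonneg hu hv))
    (((h.tendsto_limitMass hl hu).add (h.tendsto_limitMass hl hv)).congr fun n => ?_)
  rw [map_add, AbstractStateSpace.norm_add_of_nonneg _ _ (h.linBR_pow_nonneg hl n hu)
    (h.linBR_pow_nonneg hl n hv)]

theorem limitMass_linBR (h : KatoConditions A B) {l : ℝ} (hl : 0 < l) {u : X} (hu : 0 ≤ u) :
    h.limitMass hl (h.linBR hl u) = h.limitMass hl u := by
  refine tendsto_nhds_unique (h.tendsto_limitMass hl (h.linBR_nonneg hl hu))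
    (((tendsto_add_atTop_iff_nat 1).2 (h.tendsto_limitMass hl hu)).congr fun n => ?_)
  rw [pow_succ, Module.End.mul_apply]

variable {K : X →L[ℝ] X}

/-- This is `B` applied to the resolvent identity `R = R' + R K R'`, obtained by applying `R` to `(l
- A) R' x = x - K R' x`. -/
theorem linBR_eq_linBR_subBounded_add (h : KatoConditions A B)
    (h' : KatoConditions (Kato.subBounded A K) B) {l : ℝ} (hl : 0 < l) (x : X) :
    h.linBR hl x =
      h'.linBR hl x + h.linBR hl (K (resolventOp (Kato.subBounded A K) l x)) := by
  have h1 := (h.isResolvent hl).apply_smul_sub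
    (mem_graph_of_mem_graph_subBounded ((h'.isResolvent hl).apply_mem_graph x))
  rw [← sub_sub, sub_sub_cancel] at h1
  rw [← sub_eq_iff_eq_add, ← map_sub, h.linBR_apply, h1, h'.linBR_apply]

theorem norm_linBR_subBounded_add_le (h : KatoConditions A B)
    (h' : KatoConditions (Kato.subBounded A K) B) (hK : IsPositiveOp K) {l : ℝ} (hl : 0 < l)
    {x : X} (hx : 0 ≤ x) :
    ‖h'.linBR hl x‖ + l * ‖resolventOp (Kato.subBounded A K) l x‖ +
      ‖K (resolventOp (Kato.subBounded A K) l x)‖ ≤ ‖x‖ := by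
  have hR := h'.isPositiveOp_resolventOp hl x hx
  have h1 := h.massFunctional_le hR
    (mem_graph_of_mem_graph_subBounded ((h'.isResolvent hl).apply_mem_graph x))
  rw [← h'.linBR_apply hl, map_add, map_add, map_sub, map_smul, massFunctional_of_nonneg hR,
    massFunctional_of_nonneg hx, massFunctional_of_nonneg (h'.linBR_nonneg hl hx),
    massFunctional_of_nonneg (hK _ hR), smul_eq_mul] at h1
  linarith

/-- With `a = ‖K R' x‖` and `b = ‖R' x‖`, the bound `a ≤ ‖K‖ b` gives `(‖K‖ + l) a ≤ ‖K‖ (l b + a)`,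
and the mass balance bounds `l b + a`. Having a factor below `1` relies on `K` being bounded. -/
theorem norm_apply_resolventOp_subBounded_le (h : KatoConditions A B)
    (h' : KatoConditions (Kato.subBounded A K) B) (hK : IsPositiveOp K) {l : ℝ} (hl : 0 < l)
    {x : X} (hx : 0 ≤ x) :
    ‖K (resolventOp (Kato.subBounded A K) l x)‖ ≤
      ‖K‖ / (‖K‖ + l) * (‖x‖ - ‖h'.linBR hl x‖) := by
  have h1 := h.norm_linBR_subBounded_add_le h' hK hl hx
  have h2 := K.le_opNorm (resolventOp (Kato.subBounded A K) l x)
  have hk := norm_nonneg K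
  set a := ‖K (resolventOp (Kato.subBounded A K) l x)‖
  set b := ‖resolventOp (Kato.subBounded A K) l x‖
  rw [div_mul_eq_mul_div, le_div_iff₀ (by positivity)]
  have h3 := mul_le_mul_of_nonneg_left h2 hl.le
  have h4 : ‖K‖ * (l * b + a) ≤ ‖K‖ * (‖x‖ - ‖h'.linBR hl x‖) :=
    mul_le_mul_of_nonneg_left (by linarith) hk
  linarith

/-- If the iterates of `B R(l, A - K)` lose all mass, then so do those of `B R(l, A)`. -/
theorem limitMass_eq_zero_of_subBounded (h : KatoConditions A B)
    (h' : KatoConditions (Kato.subBounded A K) B) (hK : IsPositiveOp K) {l : ℝ} (hl : 0 < l)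
    (H : ∀ u : X, 0 ≤ u → Tendsto (fun n => ‖(h'.linBR hl ^ n) u‖) atTop (𝓝 0)) {u : X}
    (hu : 0 ≤ u) : h.limitMass hl u = 0 := by
  set θ := ‖K‖ / (‖K‖ + l) with hθ
  have hθ0 : 0 ≤ θ := by positivity
  have hθ1 : θ < 1 := by
    rw [hθ, div_lt_one (by positivity)]
    linarith
  -- Each induction step gains a factor `θ`, since the previous bound is applied only to the mass
  -- removed by `K`.
  have key : ∀ (m : ℕ) (v : X), 0 ≤ v → h.limitMass hl v ≤ θ ^ m * ‖v‖ := by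
    intro m
    induction m with
    | zero =>
      intro v hv
      simpa using h.limitMass_le_norm hl hv
    | succ m ih =>
      intro v hv
      have hstep : ∀ w : X, 0 ≤ w → h.limitMass hl w ≤
          h.limitMass hl (h'.linBR hl w) + θ ^ (m + 1) * (‖w‖ - ‖h'.linBR hl w‖) := by
        intro w hw
        have hKw := hK _ (h'.isPositiveOp_resolventOp hl w hw)
        rw [← h.limitMass_linBR hl hw, h.linBR_eq_linBR_subBounded_add h' hl w,
          h.limitMass_add hl (h'.linBR_nonneg hl hw) (h.linBR_nonneg hl hKw),
          h.limitMass_linBR hl hKw, pow_succ, mul_assoc]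
        gcongr
        exact (ih _ hKw).trans (mul_le_mul_of_nonneg_left
          (h.norm_apply_resolventOp_subBounded_le h' hK hl hw) (by positivity))
      -- The norm differences in `hstep` telescope along the orbit of `B R'`.
      have hN : ∀ N : ℕ, h.limitMass hl v ≤ h.limitMass hl ((h'.linBR hl ^ N) v) +
          θ ^ (m + 1) * (‖v‖ - ‖(h'.linBR hl ^ N) v‖) := by
        intro N
        induction N with
        | zero => simp
        | succ N ihN =>
          have := hstep _ (h'.linBR_pow_nonneg hl N hv)
          rw [pow_succ', Module.End.mul_apply]
          linarith
      -- The remaining limit mass is at most `‖(B R')^N v‖`, which vanishes as `N → ∞` by `H`.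
      have hlim := (H v hv).add (((H v hv).const_sub ‖v‖).const_mul (θ ^ (m + 1)))
      rw [zero_add, sub_zero] at hlim
      refine ge_of_tendsto' hlim fun N => (hN N).trans ?_
      gcongr
      exact h.limitMass_le_norm hl (h'.linBR_pow_nonneg hl N hv)
  refine le_antisymm ?_ (h.limitMass_nonneg hl hu)
  have hlim := (tendsto_pow_atTop_nhds_zero_of_lt_one hθ0 hθ1).mul_const ‖u‖
  rw [zero_mul] at hlim
  exact ge_of_tendsto' hlim fun m => key m u hu

end KatoConditions

end Comparison

end Kato

theorem mainTheorem12 {X : Type*} [NormedAddCommGroup X] [NormedSpace ℝ X] [PartialOrder X]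
    [AbstractStateSpace X]
    (A B : X →ₗ.[ℝ] X) (hAB : Kato.KatoConditions A B)
    (V : ℝ → X →L[ℝ] X) (hV : Kato.IsKatoSemigroup A B V) (hdis : Kato.IsDishonest A B V)
    (K : X →L[ℝ] X) (hK : Kato.IsPositiveOp K)
    (hAK : ∃ U : ℝ → X →L[ℝ] X, Kato.IsC0Semigroup U ∧
      Kato.generator U = Kato.subBounded A K ∧ ∀ t : ℝ, 0 ≤ t → Kato.IsPositiveOp (U t)) :
    Kato.KatoConditions (Kato.subBounded A K) B ∧
      ∀ W : ℝ → X →L[ℝ] X, Kato.IsKatoSemigroup (Kato.subBounded A K) B W →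
        Kato.IsDishonest (Kato.subBounded A K) B W := by
  have hAKB := hAB.subBounded hK hAK
  refine ⟨hAKB, fun W hW hhon => hdis ?_⟩
  refine hV.isHonest_of_tendsto hAB fun l hl u hu => ?_
  rw [← hAB.limitMass_eq_zero_of_subBounded hAKB hK hl
    (fun v hv => hW.tendsto_of_isHonest hAKB hhon hl hv) hu]
  exact hAB.tendsto_limitMass hl hu
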